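/- **Setting.** Let $(N,E)$ be a finite connected graph of buses $N$ and lines $E\subseteq N\times N$, arbitrarily oriented (so $(i,j)\in E$ implies $(j,i)\notin E$), with susceptances $B_{ij}=B_{ji}>0$. For each $j\in N$ let $M_j,\tau_j,\alpha_j,A_j,\overline d_j>0$, $p^L_j\in\mathbb R$, $\omega^1_j>\omega^0_j>0$ and $\bar p^c_j>\underline p^c_j$, and put $p^c=-\sum_{j\in N}p^L_j$. The state is $\zeta=(\eta,\omega,p^M,\sigma)\in\Lambda=\mathbb R^{|E|}\times\mathbb R^{|N|}\times\mathbb R^{|N|}\times\{0,1\}^{|N|}$. Consider the hybrid system $$\dot\zeta=\overline f(\zeta),\ \zeta\in\overline C,\qquad \zeta^+=\overline g(\zeta),\ \zeta\in\overline D,$$ given as follows. *Flow.* $\overline f$ is given by $\dot\eta_{ij}=\omega_i-\omega_j$ for $(i,j)\in E$; $M_j\dot\omega_j=-p^L_j+p^M_j-(\overline d_j\sigma_j+A_j\omega_j)-\sum_{k:(j,k)\in E}B_{jk}\eta_{jk}+\sum_{i:(i,j)\in E}B_{ij}\eta_{ij}$; $\tau_j\dot p^M_j=-(p^M_j+\alpha_j\omega_j)$;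 $\dot\sigma_j=0$. The flow set $\overline C$ consists of all $\zeta\in\Lambda$ with $\sigma_j\in\mathcal J_j(\omega_j)$ for all $j\in N$, where $\mathcal J_j(\omega_j)=\{1\}$ if $\omega_j>\omega^1_j$ or $p^c>\bar p^c_j$; $\mathcal J_j(\omega_j)=\{0\}$ if $\omega_j<\omega^0_j$ and $p^c<\underline p^c_j$; and $\mathcal J_j(\omega_j)=\{0,1\}$ otherwise. *Jumps.* The jump set is $\overline D=(\Lambda\setminus\overline C)\cup\tilde D$, where $\tilde D$ consists of all $\zeta\in\Lambda$ for which some $j\in N$ satisfies either $\sigma_j=0$ and ($\omega_j=\omega^1_j$ or $p^c=\bar p^c_j$), or else $\sigma_j=1$, $\omega_j\neq\omega^1_j$, $p^c\ne\bar p^c_j$ and (($\omega_j\le\omega^0_j$ and $p^c=\underline p^c_j$) or ($\omega_j=\omega^0_j$ and $p^c\le\underline p^c_j$)). The map $\overline g$ keeps $(\eta,\omega,p^M)$ and sets $\sigma_j^+=1$ if $\omega_j\ge\omega^1_j$ or $p^c\ge\bar p^c_j$; $\sigma_j^+=0$ if $\omega_j\le\omega^0_j$ and $p^c\le\underline p^c_j$;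 $\sigma_j^+=\sigma_j$ otherwise. *Solutions.* A hybrid time domain $K\subseteq\mathbb R_{\ge0}\times\mathbb N_0$ is a finite or infinite union of intervals $[t_l,t_{l+1}]\times\{l\}$, $0=t_0\le t_1\le\cdots$, the last of which (if any) may also be $[t_l,t_{l+1})\times\{l\}$ or $[t_l,\infty)\times\{l\}$. A solution is a function $\zeta$ on a hybrid time domain $K\ni(0,0)$ with $\zeta(0,0)\in\overline C\cup\overline D$ such that, with $T_l=\{t:(t,l)\in K\}$: each $\zeta(\cdot,l)$ is locally absolutely continuous on $T_l$; whenever $T_l$ has nonempty interior, $\zeta(t,l)\in\overline C$ for all $t\in\operatorname{int}T_l$ and $\dot\zeta(t,l)=\overline f(\zeta(t,l))$ for almost all $t\in T_l$; and $\zeta(t,l)\in\overline D$, $\zeta(t,l+1)=\overline g(\zeta(t,l))$ whenever $(t,l),(t,l+1)\in K$. It is complete if $K$ is unbounded, bounded if its range is bounded, and maximal if it is not the restriction of a solution with a strictly larger domain. Load $j$ switches at time $t$ if $(t,l),(t,l+1)\in K$ and $\sigma_j(t,l+1)\ne\sigma_j(t,l)$ for some $l$; $t_{1,j}\le t_{2,j}\le\cdots$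 denote the times of the successive switches of load $j$. **Proposition.** For every $\zeta_0\in\Lambda$ there exists a complete solution with $\zeta(0,0)=\zeta_0$, and all maximal solutions are complete. Furthermore, for every complete bounded solution there exists $\tau>0$ such that $t_{i+1,j}-t_{i,j}\ge\tau$ for all $j\in N$ and all $i\ge1$ for which $t_{i,j}$ and $t_{i+1,j}$ exist; in particular no chattering occurs: every load switches only finitely many times in any bounded time interval. -/

import Mathlib

open Set MeasureTheory

noncomputable section

/-! ### Hybrid systems -/

/-- A hybrid time domain: a union of a finite or infinite sequence of intervals
`[t l, t (l+1)] × {l}` with `0 = t 0 ≤ t 1 ≤ ⋯`, where the last interval (if there is one) may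
also be of the form `[t l, t (l+1)) × {l}` or `[t l, ∞) × {l}`. -/
def IsHybridTimeDomain (K : Set (ℝ × ℕ)) : Prop :=
  ∃ t : ℕ → ℝ, t 0 = 0 ∧ Monotone t ∧
    (K = {p | p.1 ∈ Icc (t p.2) (t (p.2 + 1))} ∨
      ∃ (L : ℕ) (I : Set ℝ),
        (I = Icc (t L) (t (L + 1)) ∨ I = Ico (t L) (t (L + 1)) ∨ I = Ici (t L)) ∧
        K = {p | (p.2 < L ∧ p.1 ∈ Icc (t p.2) (t (p.2 + 1))) ∨ (p.2 = L ∧ p.1 ∈ I)})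

/-- The slice `T_l = {t : (t, l) ∈ K}` of a hybrid time domain. -/
def hybridSlice (K : Set (ℝ × ℕ)) (l : ℕ) : Set ℝ := {t | (t, l) ∈ K}

/-- Data `(C, f, D, g)` of a hybrid system `ζ' = f ζ` for `ζ ∈ C`, `ζ⁺ = g ζ` for `ζ ∈ D`.
The values of `f` outside `C` and of `g` outside `D` are irrelevant. -/
structure HybridSystem (X : Type*) where
  /-- the flow set -/
  C : Set X
  /-- the flow map -/
  f : X → X
  /-- the jump set -/
  D : Set X
  /-- the jump map -/
  g : X → X

namespace HybridSystem

variable {X : Type*} [NormedAddCommGroup X] [NormedSpace ℝ X]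

/-- `ζ`, regarded as a function on `K`, is a solution of the hybrid system `H`.
The values `ζ t l` with `(t, l) ∉ K` play no role. -/
structure IsSolution (H : HybridSystem X) (K : Set (ℝ × ℕ)) (ζ : ℝ → ℕ → X) : Prop where
  domain : IsHybridTimeDomain K
  zero_mem : ((0 : ℝ), (0 : ℕ)) ∈ K
  init : ζ 0 0 ∈ H.C ∪ H.D
  /-- local absolute continuity on every slice -/
  locAC : ∀ (l : ℕ) (a b : ℝ), a ≤ b → Icc a b ⊆ hybridSlice K l →
    AbsolutelyContinuousOnInterval (fun t => ζ t l) a b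
  flow_mem : ∀ (l : ℕ), ∀ t ∈ interior (hybridSlice K l), ζ t l ∈ H.C
  flow_deriv : ∀ l : ℕ, (interior (hybridSlice K l)).Nonempty →
    ∀ᵐ t ∂(volume.restrict (hybridSlice K l)), HasDerivAt (fun s => ζ s l) (H.f (ζ t l)) t
  jump : ∀ (l : ℕ) (t : ℝ), (t, l) ∈ K → (t, l + 1) ∈ K →
    ζ t l ∈ H.D ∧ ζ t (l + 1) = H.g (ζ t l)

/-- A solution with domain `K` is complete if `K` is unbounded. -/
def IsCompleteSolution (H : HybridSystem X) (K : Set (ℝ × ℕ)) (ζ : ℝ → ℕ → X) : Prop :=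
  H.IsSolution K ζ ∧ ¬ Bornology.IsBounded K

/-- A solution is maximal if no solution with a strictly larger domain extends it. -/
def IsMaximalSolution (H : HybridSystem X) (K : Set (ℝ × ℕ)) (ζ : ℝ → ℕ → X) : Prop :=
  H.IsSolution K ζ ∧
    ¬ ∃ (K' : Set (ℝ × ℕ)) (ζ' : ℝ → ℕ → X), H.IsSolution K' ζ' ∧ K ⊂ K' ∧
      ∀ p ∈ K, ζ' p.1 p.2 = ζ p.1 p.2

end HybridSystem

/-! ### The power network with on-off loads -/

/-- A power network with bus set `N`, with the parameters of the generation, of the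
uncontrollable demand and of the on-off loads. -/
structure PowerNetwork (N : Type*) [Fintype N] where
  /-- transmission lines, arbitrarily oriented -/
  E : Finset (N × N)
  orient : ∀ i j, (i, j) ∈ E → (j, i) ∉ E
  connected : (SimpleGraph.fromRel fun i j => (i, j) ∈ E).Connected
  /-- line susceptances -/
  B : N → N → ℝ
  B_symm : ∀ i j, B i j = B j i
  B_pos : ∀ i j, (i, j) ∈ E → 0 < B i j
  /-- inertia -/
  M : N → ℝ
  M_pos : ∀ j, 0 < M j
  /-- frequency-independent load -/
  pL : N → ℝ
  /-- generation time constants -/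
  τ : N → ℝ
  τ_pos : ∀ j, 0 < τ j
  /-- droop coefficients -/
  α : N → ℝ
  α_pos : ∀ j, 0 < α j
  /-- damping coefficients -/
  A : N → ℝ
  A_pos : ∀ j, 0 < A j
  /-- magnitudes of the on-off loads -/
  dbar : N → ℝ
  dbar_pos : ∀ j, 0 < dbar j
  /-- lower frequency thresholds -/
  ω0 : N → ℝ
  /-- upper frequency thresholds -/
  ω1 : N → ℝ
  ω0_pos : ∀ j, 0 < ω0 j
  ω0_lt_ω1 : ∀ j, ω0 j < ω1 j
  /-- lower power command thresholds -/
  pcLow : N → ℝ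
  /-- upper power command thresholds -/
  pcHigh : N → ℝ
  pcLow_lt_pcHigh : ∀ j, pcLow j < pcHigh j

namespace PowerNetwork

variable {N : Type*} [Fintype N] [DecidableEq N] (P : PowerNetwork N)

/-- The ambient space of the states `ζ = (η, ω, p^M, σ)`. -/
abbrev State : Type _ := (P.E → ℝ) × (N → ℝ) × (N → ℝ) × (N → ℝ)

variable {P}

/-- power angle differences -/
abbrev State.η (ζ : P.State) : P.E → ℝ := ζ.1

/-- frequency deviations -/
abbrev State.ω (ζ : P.State) : N → ℝ := ζ.2.1

/-- mechanical power injections -/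
abbrev State.pM (ζ : P.State) : N → ℝ := ζ.2.2.1

/-- switching states of the loads -/
abbrev State.σ (ζ : P.State) : N → ℝ := ζ.2.2.2

variable (P)

/-- The state space `Λ = ℝⁿ × {0, 1}^|N|`, `n = |E| + 2 |N|`. -/
def Λ : Set P.State := {ζ | ∀ j, ζ.σ j ∈ ({0, 1} : Set ℝ)}

/-- The power command `p^c = - ∑ j, p^L_j`. -/
def pc : ℝ := - ∑ j, P.pL j

/-- The power `p_ij = B_ij η_ij` transmitted over the line `e = (i, j)`. -/
def lineFlow (ζ : P.State) (e : P.E) : ℝ := P.B e.1.1 e.1.2 * ζ.η e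

/-- The vector field of the continuous dynamics. -/
def flowMap (ζ : P.State) : P.State :=
  (fun e => ζ.ω e.1.1 - ζ.ω e.1.2,
   fun j => (P.M j)⁻¹ * (- P.pL j + ζ.pM j - (P.dbar j * ζ.σ j + P.A j * ζ.ω j)
      - (∑ e : P.E, if e.1.1 = j then P.lineFlow ζ e else 0)
      + (∑ e : P.E, if e.1.2 = j then P.lineFlow ζ e else 0)),
   fun j => - (P.τ j)⁻¹ * (ζ.pM j + P.α j * ζ.ω j),
   fun _ => 0)

/-- The switching states with which load `j` may flow at frequency `w`. The last case is
`ω0 ≤ w ≤ ω1` and `p^c ≤ pcHigh`, or `w ≤ ω0` and `pcLow ≤ p^c ≤ pcHigh`. -/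
def flowSwitch (j : N) (w : ℝ) : Set ℝ :=
  if P.ω1 j < w ∨ P.pcHigh j < P.pc then {1}
  else if w < P.ω0 j ∧ P.pc < P.pcLow j then {0}
  else {0, 1}

/-- The flow set. -/
def flowSet : Set P.State := {ζ | ζ ∈ P.Λ ∧ ∀ j, ζ.σ j ∈ P.flowSwitch j (ζ.ω j)}

/-- The switching states that load `j` may change at a threshold. -/
def jumpSwitch (j : N) (w : ℝ) : Set ℝ :=
  if w = P.ω1 j ∨ P.pc = P.pcHigh j then {0}
  else if (w ≤ P.ω0 j ∧ P.pc = P.pcLow j) ∨ (w = P.ω0 j ∧ P.pc ≤ P.pcLow j) then {1}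
  else ∅

/-- The jump set: some load violates the flow condition, or some load may switch at a
threshold. -/
def jumpSet : Set P.State :=
  (P.Λ \ P.flowSet) ∪ {ζ | ζ ∈ P.Λ ∧ ∃ j, ζ.σ j ∈ P.jumpSwitch j (ζ.ω j)}

/-- The jump map: the continuous state and the switching states of the loads
that meet no switching condition are left unchanged. -/
def jumpMap (ζ : P.State) : P.State :=
  (ζ.η, ζ.ω, ζ.pM, fun j =>
    if P.ω1 j ≤ ζ.ω j ∨ P.pcHigh j ≤ P.pc then 1
    else if ζ.ω j ≤ P.ω0 j ∧ P.pc ≤ P.pcLow j then 0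
    else ζ.σ j)

/-- The hybrid system of the power network. -/
def hybridSystem : HybridSystem P.State where
  C := P.flowSet
  f := P.flowMap
  D := P.jumpSet
  g := P.jumpMap

variable {P}

/-- Load `j` switches at the time `t` in the jump from `(t, l)` to `(t, l + 1)`. -/
def SwitchesAt (K : Set (ℝ × ℕ)) (ζ : ℝ → ℕ → P.State) (j : N) (l : ℕ) (t : ℝ) : Prop :=
  (t, l) ∈ K ∧ (t, l + 1) ∈ K ∧ (ζ t (l + 1)).σ j ≠ (ζ t l).σ j

/-- `s` and `s'` are the times of two consecutive switches of load `j`. -/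
def ConsecutiveSwitchTimes (K : Set (ℝ × ℕ)) (ζ : ℝ → ℕ → P.State) (j : N) (s s' : ℝ) : Prop :=
  ∃ l l' : ℕ, l < l' ∧ SwitchesAt K ζ j l s ∧ SwitchesAt K ζ j l' s' ∧
    ∀ m r, l < m → m < l' → ¬ SwitchesAt K ζ j m r

end PowerNetwork

end

/-! Between jumps the vector field is affine, hence globally Lipschitz: it has a flow for all times,
and by uniqueness every solution follows this flow on each slice (`IsSolution.eq_flow`). Three facts
about the sets do the rest: `C ∪ D = Λ` is invariant under flow and jumps, jumps lead back into it,
and `D` is closed (`mem_jumpSet_iff`, `isClosed_jumpSet`).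

Existence is greedy: flow until `D` is hit, then jump; as long as `D` is not hit, the state lies in
`C`. Either this repeats forever or the last piece flows forever, so the domain is unbounded. A
solution with bounded domain extends: a half-open last slice is closed up by the global flow; at a
closed endpoint one jumps if the state is in `D`, and otherwise flows on, since the complement of
`D` is open (`IsMaximalSolution.isComplete`).

For the dwell time, consecutive switches of a load alternate between on and off. Switching off needs
`P.pc ≤ P.pcLow j`; the power command being constant, switching on must then come from the
frequency. So the frequency crosses the gap from `P.ω0 j` to `P.ω1 j` or back, at a speed bounded
along a bounded solution (`ω1_sub_ω0_le`). -/

noncomputable section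

/-! ### Hybrid time domains -/

/-- The real numbers `t l` are the left endpoints of the slices of `K`, and consecutive nonempty
slices meet exactly at them. -/
structure HasJumpTimes (K : Set (ℝ × ℕ)) (t : ℕ → ℝ) : Prop where
  le_of_mem : ∀ {s l}, (s, l) ∈ K → t l ≤ s
  le_succ : ∀ {s r l}, (s, l) ∈ K → (r, l + 1) ∈ K → s ≤ t (l + 1)

/-- The hybrid time domain with final slice `I × {L}`. -/
def finalDomain (t : ℕ → ℝ) (L : ℕ) (I : Set ℝ) : Set (ℝ × ℕ) :=
  {p | (p.2 < L ∧ p.1 ∈ Icc (t p.2) (t (p.2 + 1))) ∨ (p.2 = L ∧ p.1 ∈ I)}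

/-- The hybrid time domain with infinitely many slices. -/
def infiniteDomain (t : ℕ → ℝ) : Set (ℝ × ℕ) := {p | p.1 ∈ Icc (t p.2) (t (p.2 + 1))}

theorem hybridSlice_finalDomain_of_lt {t : ℕ → ℝ} {L l : ℕ} (I : Set ℝ) (h : l < L) :
    hybridSlice (finalDomain t L I) l = Icc (t l) (t (l + 1)) := by
  ext s; simp [hybridSlice, finalDomain, h, h.ne]

theorem hybridSlice_finalDomain_self (t : ℕ → ℝ) (L : ℕ) (I : Set ℝ) :
    hybridSlice (finalDomain t L I) L = I := by
  ext s; simp [hybridSlice, finalDomain]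

theorem hybridSlice_finalDomain_of_gt {t : ℕ → ℝ} {L l : ℕ} (I : Set ℝ) (h : L < l) :
    hybridSlice (finalDomain t L I) l = ∅ := by
  ext s; simp [hybridSlice, finalDomain, h.not_gt, h.ne']

theorem hasJumpTimes_infiniteDomain (t : ℕ → ℝ) : HasJumpTimes (infiniteDomain t) t where
  le_of_mem h := h.1
  le_succ h _ := h.2

theorem hasJumpTimes_finalDomain {t : ℕ → ℝ} {L : ℕ} {I : Set ℝ} (hI : I ⊆ Ici (t L)) :
    HasJumpTimes (finalDomain t L I) t where
  le_of_mem := by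
    rintro s l (⟨_, h⟩ | ⟨rfl, h⟩)
    exacts [h.1, hI h]
  le_succ := by
    rintro s r l (⟨_, h⟩ | ⟨rfl, h⟩) (⟨h', _⟩ | ⟨h', _⟩)
    · exact h.2
    · exact h.2
    · exact absurd h' (by simp)
    · exact absurd h' (by simp)

/-- The left endpoints of the slices of a hybrid time domain, and the slices before a given
point of it. -/
theorem IsHybridTimeDomain.exists_jumpTimes {K : Set (ℝ × ℕ)} (hK : IsHybridTimeDomain K) :
    ∃ t : ℕ → ℝ, t 0 = 0 ∧ Monotone t ∧ HasJumpTimes K t ∧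
      (∀ s l, (s, l) ∈ K → Icc (t l) s ⊆ hybridSlice K l) ∧
      ∀ s l, (s, l) ∈ K → ∀ k < l, hybridSlice K k = Icc (t k) (t (k + 1)) := by
  obtain ⟨t, h0, hm, rfl | ⟨L, I, hI, rfl⟩⟩ := hK
  · exact ⟨t, h0, hm, hasJumpTimes_infiniteDomain t,
      fun s l h r hr => ⟨hr.1, hr.2.trans h.2⟩, fun _ _ _ _ _ => rfl⟩
  · refine ⟨t, h0, hm, hasJumpTimes_finalDomain ?_, ?_, ?_⟩
    · rcases hI with rfl | rfl | rfl
      exacts [Icc_subset_Ici_self, Ico_subset_Ici_self, subset_rfl]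
    · rintro s l (⟨h, h'⟩ | ⟨rfl, h'⟩) r hr
      · exact Or.inl ⟨h, hr.1, hr.2.trans h'.2⟩
      · refine Or.inr ⟨rfl, ?_⟩
        rcases hI with rfl | rfl | rfl
        exacts [⟨hr.1, hr.2.trans h'.2⟩, ⟨hr.1, hr.2.trans_lt h'.2⟩, hr.1]
    · rintro s l h k hk
      refine hybridSlice_finalDomain_of_lt I ?_
      rcases h with ⟨h, _⟩ | ⟨rfl, _⟩
      exacts [hk.trans h, hk]

/-! ### Solutions as pieces of trajectories of a global flow. -/

namespace HybridSystem

variable {X : Type*} [NormedAddCommGroup X] [NormedSpace ℝ X]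

/-- `Φ` is a global flow of the Lipschitz vector field `H.f`, the set `H.C ∪ H.D` is invariant
under the flow and under the jumps, and the jump set is closed. -/
structure IsFlow (H : HybridSystem X) (Φ : ℝ → X → X) : Prop where
  lipschitz : ∃ k, LipschitzWith k H.f
  zero : ∀ z, Φ 0 z = z
  deriv : ∀ z t, HasDerivAt (fun s => Φ s z) (H.f (Φ t z)) t
  flow_mem : ∀ z ∈ H.C ∪ H.D, ∀ t, Φ t z ∈ H.C ∪ H.D
  jump_mem : ∀ z ∈ H.D, H.g z ∈ H.C ∪ H.D
  isClosed : IsClosed H.D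

variable {H : HybridSystem X} {Φ : ℝ → X → X} {K : Set (ℝ × ℕ)} {ζ : ℝ → ℕ → X}

theorem IsFlow.deriv_sub (hΦ : H.IsFlow Φ) (z : X) (a t : ℝ) :
    HasDerivAt (fun s => Φ (s - a) z) (H.f (Φ (t - a) z)) t := by
  simpa using (hΦ.deriv z (t - a)).comp_sub_const t a

theorem IsFlow.continuous (hΦ : H.IsFlow Φ) (z : X) : Continuous fun s => Φ s z :=
  continuous_iff_continuousAt.2 fun t => (hΦ.deriv z t).continuousAt

theorem IsFlow.contDiff (hΦ : H.IsFlow Φ) (z : X) (a : ℝ) :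
    ContDiff ℝ 1 fun s => Φ (s - a) z := by
  obtain ⟨k, hk⟩ := hΦ.lipschitz
  refine contDiff_one_iff_deriv.2 ⟨fun t => (hΦ.deriv_sub z a t).differentiableAt, ?_⟩
  rw [show _root_.deriv (fun s => Φ (s - a) z) = fun t => H.f (Φ (t - a) z) from
    funext fun t => (hΦ.deriv_sub z a t).deriv]
  exact hk.continuous.comp ((hΦ.continuous z).comp (continuous_sub_right a))

/-- An absolutely continuous function that satisfies the differential equation almost everywhere
follows the flow. -/
theorem IsFlow.eq_of_ae [CompleteSpace X] (hΦ : H.IsFlow Φ) {x : ℝ → X} {a b : ℝ} (hab : a ≤ b)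
    (hx : AbsolutelyContinuousOnInterval x a b)
    (hd : ∀ᵐ t, t ∈ Icc a b → HasDerivAt x (H.f (x t)) t) :
    ∀ t ∈ Icc a b, x t = Φ (t - a) (x a) := by
  obtain ⟨k, hk⟩ := hΦ.lipschitz
  have hc : ContinuousOn x (Icc a b) := by simpa [uIcc_of_le hab] using hx.continuousOn
  -- Extending `x` by constants makes the integrand below continuous on all of `ℝ`, so its primitive
  -- `G` is `C¹`; `x - G` has zero derivative almost everywhere and is therefore constant.
  set y : ℝ → X := IccExtend hab ((Icc a b).domRestrict x) with hy
  have hyc : Continuous y := (continuousOn_iff_continuous_domRestrict.1 hc).Icc_extend'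
  have hyx : ∀ t ∈ Icc a b, y t = x t := fun t ht => by
    rw [hy, IccExtend_of_mem _ _ ht]; rfl
  have hfc : Continuous fun t => H.f (y t) := hk.continuous.comp hyc
  set G : ℝ → X := fun t => x a + ∫ s in a..t, H.f (y s) with hG
  have hGd : ∀ t, HasDerivAt G (H.f (y t)) t := fun t =>
    (hfc.integral_hasStrictDerivAt a t).hasDerivAt.const_add _
  have hGC : ContDiff ℝ 1 G := by
    refine contDiff_one_iff_deriv.2 ⟨fun t => (hGd t).differentiableAt, ?_⟩
    rw [show _root_.deriv G = fun t => H.f (y t) from funext fun t => (hGd t).deriv]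
    exact hfc
  obtain ⟨c, hcst⟩ := (hx.sub hGC.contDiffOn.absolutelyContinuousOnInterval)
    |>.const_of_ae_hasDerivAt_zero (by
      filter_upwards [hd] with t ht htm
      rw [uIcc_of_le hab] at htm
      have := (ht htm).sub (hGd t)
      rwa [hyx t htm, sub_self] at this)
  rw [uIcc_of_le hab] at hcst
  have hxG : ∀ t ∈ Icc a b, x t = G t := by
    have h0 : c = 0 := by
      rw [← hcst a (left_mem_Icc.2 hab)]; simp [hG]
    intro t ht
    have := hcst t ht
    rw [h0] at this
    exact sub_eq_zero.1 this
  have := ODE_solution_unique (v := fun _ => H.f) (fun _ => hk) (a := a) (b := b) (f := G)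
    (g := fun t => Φ (t - a) (x a)) hGC.continuous.continuousOn
    (fun t ht => by
      rw [← hxG t (Ico_subset_Icc_self ht), ← hyx t (Ico_subset_Icc_self ht)]
      exact (hGd t).hasDerivWithinAt)
    ((hΦ.contDiff (x a) a).continuous.continuousOn)
    (fun t _ => (hΦ.deriv_sub _ _ t).hasDerivWithinAt) (by simp [hG, hΦ.zero])
  intro t ht
  rw [hxG t ht, this ht]

/-- On each slice, solutions follow the flow. -/
theorem IsSolution.eq_flow [CompleteSpace X] (hΦ : H.IsFlow Φ) (hζ : H.IsSolution K ζ)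
    {l : ℕ} {a b : ℝ} (hab : a ≤ b) (h : Icc a b ⊆ hybridSlice K l) :
    ζ b l = Φ (b - a) (ζ a l) := by
  -- Degenerate slices carry no differential equation, so a single point is treated apart.
  rcases hab.eq_or_lt with rfl | hlt
  · simp [hΦ.zero]
  · have hne : (interior (hybridSlice K l)).Nonempty := by
      refine (nonempty_Ioo.2 hlt).mono ?_
      rw [← interior_Icc]
      exact interior_mono h
    refine hΦ.eq_of_ae hab (hζ.locAC l a b hab h) ?_ b (right_mem_Icc.2 hab)
    exact (ae_restrict_iff' measurableSet_Icc).1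
      (ae_mono (Measure.restrict_mono h le_rfl) (hζ.flow_deriv l hne))

/-- Solutions stay in `C ∪ D`. -/
theorem IsSolution.mem_union [CompleteSpace X] (hΦ : H.IsFlow Φ) (hζ : H.IsSolution K ζ)
    {s : ℝ} {l : ℕ} (h : (s, l) ∈ K) : ζ s l ∈ H.C ∪ H.D := by
  obtain ⟨t, h0, hm, hJ, hI, hS⟩ := hζ.domain.exists_jumpTimes
  induction l generalizing s with
  | zero =>
    rw [hζ.eq_flow hΦ (hJ.le_of_mem h) (hI s 0 h), h0]
    exact hΦ.flow_mem _ hζ.init _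
  | succ l ih =>
    rw [hζ.eq_flow hΦ (hJ.le_of_mem h) (hI s _ h)]
    have h1 : (t (l + 1), l) ∈ K := by
      change _ ∈ hybridSlice K l
      rw [hS s _ h l (by simp)]
      exact right_mem_Icc.2 (hm (by simp))
    have h2 := hI s _ h (left_mem_Icc.2 (hJ.le_of_mem h))
    have h3 := hζ.jump l _ h1 h2
    rw [h3.2]
    exact hΦ.flow_mem _ (hΦ.jump_mem _ h3.1) _

/-- A sequence of pieces of trajectories, joined by jumps, is a solution. -/
theorem IsFlow.isSolution (hΦ : H.IsFlow Φ) {t : ℕ → ℝ} (hK : IsHybridTimeDomain K)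
    (h0 : ((0 : ℝ), 0) ∈ K) (ht0 : t 0 = 0) (hJ : HasJumpTimes K t) {z : ℕ → X}
    (hz : z 0 ∈ H.C ∪ H.D)
    (hC : ∀ l, ∀ s ∈ interior (hybridSlice K l), Φ (s - t l) (z l) ∈ H.C)
    (hD : ∀ l, (t (l + 1), l) ∈ K → (t (l + 1), l + 1) ∈ K →
      Φ (t (l + 1) - t l) (z l) ∈ H.D ∧ z (l + 1) = H.g (Φ (t (l + 1) - t l) (z l))) :
    H.IsSolution K fun s l => Φ (s - t l) (z l) where
  domain := hK
  zero_mem := h0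
  init := by simpa [ht0, hΦ.zero] using hz
  locAC l a b _ _ := (hΦ.contDiff _ _).contDiffOn.absolutelyContinuousOnInterval
  flow_mem := hC
  flow_deriv l _ := Filter.Eventually.of_forall fun s => hΦ.deriv_sub _ _ s
  jump l s h h' := by
    obtain rfl : s = t (l + 1) := le_antisymm (hJ.le_succ h h') (hJ.le_of_mem h')
    simpa [hΦ.zero] using hD l h h'

/-! ### Existence of complete solutions -/

/-- The time at which the trajectory from `z` reaches the jump set. -/
def hitTime (H : HybridSystem X) (Φ : ℝ → X → X) (z : X) : ℝ := sInf {s | 0 ≤ s ∧ Φ s z ∈ H.D}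

theorem hitTime_nonneg {Y : Type*} (H : HybridSystem Y) (Φ : ℝ → Y → Y) (z : Y) : 0 ≤ H.hitTime Φ z := Real.sInf_nonneg fun _ h => h.1

/-- The set of hitting times is closed because `D` is, so the infimum is attained. -/
theorem IsFlow.hitTime_mem (hΦ : H.IsFlow Φ) {z : X} (h : ∃ s, 0 ≤ s ∧ Φ s z ∈ H.D) :
    Φ (H.hitTime Φ z) z ∈ H.D := by
  have : IsClosed {s : ℝ | 0 ≤ s ∧ Φ s z ∈ H.D} :=
    isClosed_Ici.inter (hΦ.isClosed.preimage (hΦ.continuous z))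
  exact (this.csInf_mem h ⟨0, fun _ h => h.1⟩).2

theorem IsFlow.mem_C_of_lt_hitTime (hΦ : H.IsFlow Φ) {z : X} (hz : z ∈ H.C ∪ H.D) {s : ℝ}
    (h0 : 0 ≤ s) (h : s < H.hitTime Φ z) : Φ s z ∈ H.C :=
  (hΦ.flow_mem z hz s).resolve_right fun hD =>
    h.not_ge (csInf_le ⟨0, fun _ h => h.1⟩ ⟨h0, hD⟩)

/-- The states after the successive jumps of the solution from `z`. -/
def jumpStates (H : HybridSystem X) (Φ : ℝ → X → X) (z : X) : ℕ → X
  | 0 => z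
  | n + 1 => H.g (Φ (H.hitTime Φ (jumpStates H Φ z n)) (jumpStates H Φ z n))

/-- The times of the successive jumps of the solution from `z`. -/
def jumpTimes (H : HybridSystem X) (Φ : ℝ → X → X) (z : X) (n : ℕ) : ℝ :=
  ∑ k ∈ Finset.range n, H.hitTime Φ (H.jumpStates Φ z k)

theorem jumpTimes_succ {Y : Type*} (H : HybridSystem Y) (Φ : ℝ → Y → Y) (z : Y) (n : ℕ) : H.jumpTimes Φ z (n + 1) =
    H.jumpTimes Φ z n + H.hitTime Φ (H.jumpStates Φ z n) := Finset.sum_range_succ _ _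

theorem monotone_jumpTimes {Y : Type*} (H : HybridSystem Y) (Φ : ℝ → Y → Y) (z : Y) : Monotone (H.jumpTimes Φ z) :=
  monotone_nat_of_le_succ fun n => by
    rw [jumpTimes_succ]; linarith [hitTime_nonneg H Φ (H.jumpStates Φ z n)]

theorem IsFlow.jumpStates_mem (hΦ : H.IsFlow Φ) {z : X} (hz : z ∈ H.C ∪ H.D) {n : ℕ}
    (h : ∀ k < n, ∃ s, 0 ≤ s ∧ Φ s (H.jumpStates Φ z k) ∈ H.D) :
    H.jumpStates Φ z n ∈ H.C ∪ H.D := by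
  cases n with
  | zero => exact hz
  | succ n => exact hΦ.jump_mem _ (hΦ.hitTime_mem (h n (by simp)))

theorem not_isBounded_infiniteDomain {t : ℕ → ℝ} (ht : Monotone t) :
    ¬ Bornology.IsBounded (infiniteDomain t) := by
  intro h
  have h2 := h.image_snd
  have : Prod.snd '' infiniteDomain t = univ :=
    eq_univ_of_forall fun n => ⟨(t n, n), left_mem_Icc.2 (ht (by simp)), rfl⟩
  rw [this] at h2
  obtain ⟨C, hC⟩ := Metric.isBounded_iff.1 h2
  obtain ⟨n, hn⟩ := exists_nat_gt C
  have := hC (mem_univ n) (mem_univ 0)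
  rw [Nat.dist_eq] at this
  simp at this
  linarith

theorem not_isBounded_finalDomain_Ici (t : ℕ → ℝ) (L : ℕ) :
    ¬ Bornology.IsBounded (finalDomain t L (Ici (t L))) := by
  intro h
  have h2 := h.image_fst
  have : Ici (t L) ⊆ Prod.fst '' finalDomain t L (Ici (t L)) := fun s hs =>
    ⟨(s, L), Or.inr ⟨rfl, hs⟩, rfl⟩
  obtain ⟨C, hC⟩ := (h2.subset this).bddAbove
  linarith [hC (show max (t L) C + 1 ∈ Ici (t L) from by
    rw [mem_Ici]; linarith [le_max_left (t L) C]), le_max_right (t L) C]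

theorem IsFlow.exists_complete (hΦ : H.IsFlow Φ) {z : X} (hz : z ∈ H.C ∪ H.D) :
    ∃ (K : Set (ℝ × ℕ)) (ζ : ℝ → ℕ → X), H.IsCompleteSolution K ζ ∧ ζ 0 0 = z := by
  classical
  set t := H.jumpTimes Φ z with ht
  have ht0 : t 0 = 0 := by simp [ht, jumpTimes]
  have hm : Monotone t := monotone_jumpTimes H Φ z
  have hsucc : ∀ l, t (l + 1) - t l = H.hitTime Φ (H.jumpStates Φ z l) := fun l => by
    rw [ht, jumpTimes_succ]; ring
  have hζ0 : Φ (0 - t 0) (H.jumpStates Φ z 0) = z := by rw [ht0, sub_zero, hΦ.zero]; rfl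
  have hIoo : ∀ l, H.jumpStates Φ z l ∈ H.C ∪ H.D →
      ∀ s ∈ interior (Icc (t l) (t (l + 1))), Φ (s - t l) (H.jumpStates Φ z l) ∈ H.C := by
    intro l hl s hs
    rw [interior_Icc] at hs
    refine hΦ.mem_C_of_lt_hitTime hl (sub_nonneg.2 hs.1.le) ?_
    rw [← hsucc]; linarith [hs.2]
  have hjump : ∀ l, (∃ s, 0 ≤ s ∧ Φ s (H.jumpStates Φ z l) ∈ H.D) →
      Φ (t (l + 1) - t l) (H.jumpStates Φ z l) ∈ H.D ∧
      H.jumpStates Φ z (l + 1) = H.g (Φ (t (l + 1) - t l) (H.jumpStates Φ z l)) := by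
    intro l hl
    rw [hsucc]
    exact ⟨hΦ.hitTime_mem hl, rfl⟩
  by_cases hall : ∀ k, ∃ s, 0 ≤ s ∧ Φ s (H.jumpStates Φ z k) ∈ H.D
  -- The jump times may accumulate, or even all coincide; the domain is still unbounded in the jump
  -- counter.
  · refine ⟨infiniteDomain t, fun s l => Φ (s - t l) (H.jumpStates Φ z l),
      ⟨hΦ.isSolution ⟨t, ht0, hm, Or.inl rfl⟩ ?_ ht0 (hasJumpTimes_infiniteDomain t) hz
        (fun l => hIoo l (hΦ.jumpStates_mem hz fun k _ => hall k)) (fun l _ _ => hjump l (hall l)),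
        not_isBounded_infiniteDomain hm⟩, hζ0⟩
    exact ⟨ht0.le, ht0 ▸ hm (by simp)⟩
  · push Not at hall
    set L := Nat.find hall with hL
    have hlt : ∀ k < L, ∃ s, 0 ≤ s ∧ Φ s (H.jumpStates Φ z k) ∈ H.D := fun k hk => by
      have := Nat.find_min hall hk
      push Not at this
      exact this
    have hge := Nat.find_spec hall
    -- From the `L`-th state on, `t` may contain the default `sInf ∅ = 0` as a hitting time, but
    -- this domain uses `t` only up to `t L`.
    refine ⟨finalDomain t L (Ici (t L)), fun s l => Φ (s - t l) (H.jumpStates Φ z l),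
      ⟨hΦ.isSolution (K := finalDomain t L (Ici (t L))) ⟨t, ht0, hm, Or.inr ⟨L, _, Or.inr (Or.inr rfl), rfl⟩⟩ ?_ ht0
        (hasJumpTimes_finalDomain subset_rfl) hz ?_ ?_, not_isBounded_finalDomain_Ici t L⟩, hζ0⟩
    · rcases Nat.eq_zero_or_pos L with h | h
      · exact Or.inr ⟨h.symm, by rw [h, ht0]; exact self_mem_Ici⟩
      · exact Or.inl ⟨h, ht0.le, ht0 ▸ hm (by simp)⟩
    · intro l s hs
      rcases lt_trichotomy l L with h | rfl | h
      · rw [hybridSlice_finalDomain_of_lt _ h] at hs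
        exact hIoo l (hΦ.jumpStates_mem hz fun k hk => hlt k (hk.trans h)) s hs
      · rw [hybridSlice_finalDomain_self, interior_Ici] at hs
        have hs0 : 0 ≤ s - t L := sub_nonneg.2 (le_of_lt hs)
        exact (hΦ.flow_mem _ (hΦ.jumpStates_mem hz hlt) _).resolve_right (hge _ hs0)
      · rw [hybridSlice_finalDomain_of_gt _ h] at hs
        simp at hs
    · rintro l - (⟨h, -⟩ | ⟨h, -⟩)
      · exact hjump l (hlt l ((Nat.lt_succ_self l).trans h))
      · exact hjump l (hlt l (by rw [← h]; exact Nat.lt_succ_self l))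

/-! ### Maximal solutions are complete -/

section Extension

variable [CompleteSpace X] {t : ℕ → ℝ} {L : ℕ} {I : Set ℝ}

/-- A solution whose last slice starts at `t L` can be continued along the flow up to the time
`b`, if the flow stays in `C`. -/
theorem IsSolution.exists_flow_extension (hΦ : H.IsFlow Φ)
    (hζ : H.IsSolution (finalDomain t L I) ζ) (h0 : t 0 = 0) (hm : Monotone t) (hL : t L ∈ I)
    {b : ℝ} (hIb : I ⊆ Icc (t L) b) (hconn : I.OrdConnected)
    (hC : ∀ s ∈ Ioo (t L) b, Φ (s - t L) (ζ (t L) L) ∈ H.C) :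
    ∃ ζ', H.IsSolution (finalDomain t L (Icc (t L) b)) ζ' ∧
      ∀ p ∈ finalDomain t L I, ζ' p.1 p.2 = ζ p.1 p.2 := by
  -- By uniqueness the old solution is already given by the flow formula, so the same formula
  -- defines the extension.
  have heq : ∀ p ∈ finalDomain t L I, Φ (p.1 - t p.2) (ζ (t p.2) p.2) = ζ p.1 p.2 := by
    rintro ⟨s, l⟩ hp
    refine (hζ.eq_flow hΦ ?_ ?_).symm
    · rcases hp with ⟨_, h⟩ | ⟨rfl, h⟩
      exacts [h.1, (hIb h).1]
    · rcases hp with ⟨hl, h⟩ | ⟨rfl, h⟩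
      · rw [hybridSlice_finalDomain_of_lt _ hl]
        exact Icc_subset_Icc_right h.2
      · rw [hybridSlice_finalDomain_self]
        exact hconn.out hL h
  have hb : t L ≤ b := (hIb hL).2
  refine ⟨fun s l => Φ (s - t l) (ζ (t l) l), hΦ.isSolution ?_ ?_ h0
    (hasJumpTimes_finalDomain Icc_subset_Ici_self) ?_ ?_ ?_, heq⟩
  -- The values of `t` beyond `L` need not fit `b`, so they are replaced by `b`.
  · refine ⟨fun k => if k ≤ L then t k else b, by simp [h0], ?_, Or.inr ⟨L, Icc (t L) b,
      Or.inl (by simp), ?_⟩⟩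
    · intro k l hkl
      by_cases h1 : l ≤ L
      · simpa [h1, hkl.trans h1] using hm hkl
      · by_cases h2 : k ≤ L
        · simpa [h1, h2] using (hm h2).trans hb
        · simp [h1, h2]
    · ext ⟨s, l⟩
      refine or_congr (and_congr_right fun h => ?_) Iff.rfl
      have h : l < L := h
      simp [h.le, Nat.succ_le_of_lt h]
  · rcases Nat.eq_zero_or_pos L with rfl | h
    · exact Or.inr ⟨rfl, by rw [← h0]; exact left_mem_Icc.2 hb⟩
    · exact Or.inl ⟨h, h0.le, h0 ▸ hm (by simp)⟩
  · simpa [h0] using hζ.init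
  · intro l s hs
    rcases lt_trichotomy l L with h | rfl | h
    · rw [hybridSlice_finalDomain_of_lt _ h] at hs
      rw [heq (s, l) (Or.inl ⟨h, interior_subset hs⟩)]
      refine hζ.flow_mem l s ?_
      rwa [hybridSlice_finalDomain_of_lt _ h]
    · rw [hybridSlice_finalDomain_self, interior_Icc] at hs
      exact hC s hs
    · rw [hybridSlice_finalDomain_of_gt _ h] at hs
      simp at hs
  · intro l _ h'
    have hl : l < L := by
      rcases h' with ⟨h, _⟩ | ⟨h, _⟩
      exacts [(Nat.lt_succ_self l).trans h, h ▸ Nat.lt_succ_self l]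
    have h1 : (t (l + 1), l) ∈ finalDomain t L I :=
      Or.inl ⟨hl, right_mem_Icc.2 (hm (by simp))⟩
    rw [heq _ h1]
    refine hζ.jump l _ h1 ?_
    rcases (Nat.succ_le_of_lt hl).lt_or_eq with h | h
    · exact Or.inl ⟨h, left_mem_Icc.2 (hm (by simp))⟩
    · exact Or.inr ⟨h, by have h : l + 1 = L := h
                          rw [h]; exact hL⟩

/-- A solution whose last slice ends at a time at which a jump is possible can be continued by
this jump. -/
theorem IsSolution.exists_jump_extension (hΦ : H.IsFlow Φ)
    (hζ : H.IsSolution (finalDomain t L (Icc (t L) (t (L + 1)))) ζ) (h0 : t 0 = 0)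
    (hm : Monotone t) (hD : ζ (t (L + 1)) L ∈ H.D) :
    ∃ ζ', H.IsSolution (finalDomain t (L + 1) {t (L + 1)}) ζ' ∧
      ∀ p ∈ finalDomain t L (Icc (t L) (t (L + 1))), ζ' p.1 p.2 = ζ p.1 p.2 := by
  have hmem : ∀ s l, (s, l) ∈ finalDomain t L (Icc (t L) (t (L + 1))) ↔
      l ≤ L ∧ s ∈ Icc (t l) (t (l + 1)) := by
    intro s l
    constructor
    · rintro (⟨h, h'⟩ | ⟨rfl, h'⟩)
      exacts [⟨h.le, h'⟩, ⟨le_rfl, h'⟩]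
    · rintro ⟨h, h'⟩
      rcases h.lt_or_eq with h | rfl
      exacts [Or.inl ⟨h, h'⟩, Or.inr ⟨rfl, h'⟩]
  set z : ℕ → X := fun l => if l ≤ L then ζ (t l) l else H.g (ζ (t (L + 1)) L) with hz
  have heq : ∀ s l, l ≤ L → s ∈ Icc (t l) (t (l + 1)) → Φ (s - t l) (z l) = ζ s l := by
    intro s l hl hs
    rw [hz]
    simp only [hl, if_true]
    exact (hζ.eq_flow hΦ hs.1 fun r hr => (hmem r l).2 ⟨hl, hr.1, hr.2.trans hs.2⟩).symm
  refine ⟨fun s l => Φ (s - t l) (z l), hΦ.isSolution ?_ ?_ h0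
    (hasJumpTimes_finalDomain (by simp)) ?_ ?_ ?_, ?_⟩
  -- Freezing the times after index `L + 1` makes the last interval the single point `t (L + 1)`.
  · refine ⟨fun k => t (min k (L + 1)), by simp [h0], fun k l hkl => hm (by omega),
      Or.inr ⟨L + 1, {t (L + 1)}, Or.inl (by simp), ?_⟩⟩
    ext ⟨s, l⟩
    refine or_congr (and_congr_right fun h => ?_) Iff.rfl
    have h : l < L + 1 := h
    simp [h.le, Nat.le_of_lt_succ h]
  · exact Or.inl ⟨Nat.succ_pos L, h0.le, h0 ▸ hm (by simp)⟩
  · simpa [hz, h0] using hζ.init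
  · intro l s hs
    rcases lt_trichotomy l (L + 1) with h | rfl | h
    · rw [hybridSlice_finalDomain_of_lt _ h] at hs
      rw [heq s l (Nat.le_of_lt_succ h) (interior_subset hs)]
      refine hζ.flow_mem l s ?_
      convert! hs using 2
      ext r
      exact (hmem r l).trans (and_iff_right (Nat.le_of_lt_succ h))
    · rw [hybridSlice_finalDomain_self] at hs
      simp at hs
    · rw [hybridSlice_finalDomain_of_gt _ h] at hs
      simp at hs
  · intro l _ h'
    have hl : l ≤ L := by
      rcases h' with ⟨h, _⟩ | ⟨h, _⟩
      · exact (Nat.lt_of_succ_lt_succ h).le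
      · exact (Nat.succ_injective h).le
    rw [heq _ l hl (right_mem_Icc.2 (hm (by simp)))]
    rcases hl.lt_or_eq with h | rfl
    · have := hζ.jump l (t (l + 1)) ((hmem _ _).2 ⟨hl, right_mem_Icc.2 (hm (by simp))⟩)
        ((hmem _ _).2 ⟨h, left_mem_Icc.2 (hm (by simp))⟩)
      simpa [hz, Nat.succ_le_of_lt h] using this
    · simpa [hz] using hD
  · rintro ⟨s, l⟩ hp
    obtain ⟨h, h'⟩ := (hmem s l).1 hp
    exact heq s l h h'

/-- A solution on a compact hybrid time domain is not maximal. -/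
theorem IsSolution.not_isMaximal_of_Icc (hΦ : H.IsFlow Φ)
    (hζ : H.IsSolution (finalDomain t L (Icc (t L) (t (L + 1)))) ζ) (h0 : t 0 = 0)
    (hm : Monotone t) : ¬ H.IsMaximalSolution (finalDomain t L (Icc (t L) (t (L + 1)))) ζ := by
  rintro ⟨-, hmax⟩
  refine hmax ?_
  set T := t (L + 1) with hT
  have hLT : t L ≤ T := hm (by simp)
  by_cases hD : ζ T L ∈ H.D
  · obtain ⟨ζ', h1, h2⟩ := hζ.exists_jump_extension hΦ h0 hm hD
    refine ⟨_, ζ', h1, ?_, h2⟩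
    refine ssubset_iff_exists.2 ⟨?_, (T, L + 1), Or.inr ⟨rfl, rfl⟩, ?_⟩
    · rintro ⟨s, l⟩ (⟨h, h'⟩ | ⟨h, h'⟩)
      · exact Or.inl ⟨Nat.lt_succ_of_lt h, h'⟩
      · have h : l = L := h
        subst h
        exact Or.inl ⟨Nat.lt_succ_self l, h'⟩
    · rintro (⟨h, _⟩ | ⟨h, _⟩) <;> simp at h
  · have hΦT : Φ (T - t L) (ζ (t L) L) = ζ T L :=
      (hζ.eq_flow hΦ hLT (by rw [hybridSlice_finalDomain_self])).symm
    have hev : ∀ᶠ s in nhds T, Φ (s - t L) (ζ (t L) L) ∈ H.Dᶜ := by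
      refine (hΦ.contDiff (ζ (t L) L) (t L)).continuous.continuousAt.eventually_mem ?_
      rw [hΦT]
      exact hΦ.isClosed.isOpen_compl.mem_nhds hD
    -- The trajectory avoids `D` within distance `ε` of `T`; by invariance of `C ∪ D` it is then in
    -- `C`, so `ε / 2` more time is available.
    obtain ⟨ε, hε, hball⟩ := Metric.eventually_nhds_iff.1 hev
    have hS : ζ (t L) L ∈ H.C ∪ H.D := hζ.mem_union hΦ (Or.inr ⟨rfl, left_mem_Icc.2 hLT⟩)
    obtain ⟨ζ', h1, h2⟩ := hζ.exists_flow_extension (b := T + ε / 2) hΦ h0 hm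
      (left_mem_Icc.2 hLT) (Icc_subset_Icc_right (by linarith)) ordConnected_Icc (by
        intro s hs
        rcases lt_or_ge s T with h | h
        · rw [← hζ.eq_flow hΦ hs.1.le (by
            rw [hybridSlice_finalDomain_self]; exact Icc_subset_Icc_right h.le)]
          refine hζ.flow_mem L s ?_
          rw [hybridSlice_finalDomain_self, interior_Icc]
          exact ⟨hs.1, h⟩
        · refine (hΦ.flow_mem _ hS _).resolve_right (hball ?_)
          rw [Real.dist_eq, abs_of_nonneg (by linarith)]
          linarith [hs.2])
    refine ⟨_, ζ', h1, ?_, h2⟩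
    refine ssubset_iff_exists.2 ⟨?_, (T + ε / 2, L), Or.inr ⟨rfl, by constructor <;> linarith⟩, ?_⟩
    · rintro ⟨s, l⟩ (h | ⟨h, h'⟩)
      · exact Or.inl h
      · exact Or.inr ⟨h, h'.1, h'.2.trans (by linarith)⟩
    · rintro (⟨h, _⟩ | ⟨_, h⟩)
      · simp at h
      · have : T + ε / 2 ≤ T := h.2
        linarith

theorem IsMaximalSolution.isComplete (hΦ : H.IsFlow Φ) (hζ : H.IsMaximalSolution K ζ) :
    H.IsCompleteSolution K ζ := by
  refine ⟨hζ.1, fun hB => ?_⟩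
  obtain ⟨t, h0, hm, hK | ⟨L, I, hI, hK⟩⟩ := hζ.1.domain
  · rw [hK] at hB
    exact not_isBounded_infiniteDomain hm hB
  · change K = finalDomain t L I at hK
    subst hK
    rcases hI with rfl | rfl | rfl
    · exact hζ.1.not_isMaximal_of_Icc hΦ h0 hm hζ
    -- With equal endpoints the half-open slice is empty: the domain really ends with the compact
    -- slice before it, which exists because `(0, 0) ∈ K`.
    · rcases (hm (Nat.le_succ L)).eq_or_lt with heq | hlt
      · have h00 := hζ.1.zero_mem
        cases L with
        | zero =>
          rcases h00 with ⟨h, _⟩ | ⟨_, h, h'⟩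
          · simp at h
          · have h' : (0 : ℝ) < t (0 + 1) := h'
            have heq : t 0 = t (0 + 1) := heq
            linarith
        | succ L =>
          have hdom : finalDomain t (L + 1) (Ico (t (L + 1)) (t (L + 1 + 1))) =
              finalDomain t L (Icc (t L) (t (L + 1))) := by
            have heq : t (L + 1) = t (L + 1 + 1) := heq
            ext ⟨s, l⟩
            rw [← heq, Ico_self]
            constructor
            · rintro (⟨h, h'⟩ | ⟨_, h⟩)
              · rcases (Nat.le_of_lt_succ h).lt_or_eq with h | h
                · exact Or.inl ⟨h, h'⟩
                · have h : l = L := h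
                  subst h
                  exact Or.inr ⟨rfl, h'⟩
              · exact h.elim
            · rintro (⟨h, h'⟩ | ⟨h, h'⟩)
              · exact Or.inl ⟨Nat.lt_succ_of_lt h, h'⟩
              · have h : l = L := h
                subst h
                exact Or.inl ⟨Nat.lt_succ_self l, h'⟩
          rw [hdom] at hζ
          exact hζ.1.not_isMaximal_of_Icc hΦ h0 hm hζ
      · have hlt : t L < t (L + 1) := hlt
        obtain ⟨ζ', h1, h2⟩ := hζ.1.exists_flow_extension (b := t (L + 1)) hΦ h0 hm
          (left_mem_Ico.2 hlt) Ico_subset_Icc_self ordConnected_Ico (by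
            intro s hs
            rw [← hζ.1.eq_flow hΦ hs.1.le (by
              rw [hybridSlice_finalDomain_self]
              exact fun r hr => ⟨hr.1, hr.2.trans_lt hs.2⟩)]
            refine hζ.1.flow_mem L s ?_
            rw [hybridSlice_finalDomain_self, interior_Ico]
            exact hs)
        refine hζ.2 ⟨_, ζ', h1, ?_, h2⟩
        refine ssubset_iff_exists.2 ⟨?_, (t (L + 1), L), Or.inr ⟨rfl, right_mem_Icc.2 hlt.le⟩, ?_⟩
        · rintro p (h | ⟨h, h'⟩)
          · exact Or.inl h
          · exact Or.inr ⟨h, Ico_subset_Icc_self h'⟩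
        · rintro (⟨h, _⟩ | ⟨_, h⟩)
          · simp at h
          · exact (lt_irrefl _ h.2).elim
    · exact not_isBounded_finalDomain_Ici t L hB

end Extension

end HybridSystem

/-! ### The flow of an affine vector field -/

section AffineFlow

variable {X : Type*} [NormedAddCommGroup X] [NormedSpace ℝ X]

/-- The linear map `(z, r) ↦ (A z + r • c, 0)`, which extends the affine map `z ↦ A z + c`. -/
def homogenization (A : X →L[ℝ] X) (c : X) : X × ℝ →L[ℝ] X × ℝ :=
  (A.comp (ContinuousLinearMap.fst ℝ X ℝ) +
    (ContinuousLinearMap.snd ℝ X ℝ).smulRight c).prod 0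

/-- The flow of the affine vector field `z ↦ A z + c`. -/
def affineFlow (A : X →L[ℝ] X) (c : X) (t : ℝ) (z : X) : X :=
  (NormedSpace.exp (t • homogenization A c) (z, 1)).1

theorem affineFlow_zero (A : X →L[ℝ] X) (c z : X) : affineFlow A c 0 z = z := by
  simp [affineFlow]

/-- The second component of the homogenized linear flow has zero derivative, so it keeps its initial
value `1`, and the first component sees the constant term `c` with weight `1`. -/
theorem hasDerivAt_affineFlow [CompleteSpace X] (A : X →L[ℝ] X) (c z : X) (t : ℝ) :
    HasDerivAt (fun s => affineFlow A c s z) (A (affineFlow A c t z) + c) t := by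
  set x : ℝ → X × ℝ := fun s => NormedSpace.exp (s • homogenization A c) (z, 1) with hx
  have hd : ∀ s, HasDerivAt x (homogenization A c (x s)) s := fun s => by
    simpa using (hasDerivAt_exp_smul_const' (𝕂 := ℝ) (homogenization A c) s).clm_apply
      (hasDerivAt_const s ((z, 1) : X × ℝ))
  have h2 : ∀ s, HasDerivAt (fun s => (x s).2) 0 s := fun s => by
    simpa [homogenization] using hasDerivAt_iff_hasFDerivAt.2 (hd s).hasFDerivAt.snd
  have h1 : ∀ s, (x s).2 = 1 := fun s => by
    have h := is_const_of_deriv_eq_zero (f := fun s => (x s).2)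
      (fun s => (h2 s).differentiableAt) (fun s => (h2 s).deriv) s 0
    rw [h]
    simp [hx]
  have h3 : HasDerivAt (fun s => (x s).1) (homogenization A c (x t)).1 t := by
    simpa using hasDerivAt_iff_hasFDerivAt.2 (hd t).hasFDerivAt.fst
  have h4 : (homogenization A c (x t)).1 = A (x t).1 + c := by simp [homogenization, h1 t]
  rwa [h4] at h3

end AffineFlow

/-! ### The jump set and the flow of the power network. -/

namespace PowerNetwork

variable {N : Type*} [Fintype N] (P : PowerNetwork N)

theorem flowSet_union_jumpSet : P.flowSet ∪ P.jumpSet = P.Λ := by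
  ext ζ
  simp only [jumpSet, flowSet, mem_union, mem_sdiff, mem_ofPred_eq]
  constructor
  · rintro (h | h | h)
    exacts [h.1, h.1, h.1]
  · intro h
    by_cases hC : ∀ j, ζ.σ j ∈ P.flowSwitch j (ζ.ω j)
    exacts [Or.inl ⟨h, hC⟩, Or.inr (Or.inl ⟨h, fun h' => hC h'.2⟩)]

theorem jumpMap_mem_Λ {ζ : P.State} (h : ζ ∈ P.Λ) : P.jumpMap ζ ∈ P.Λ := by
  intro j
  have := h j
  simp only [jumpMap, State.σ]
  split_ifs <;> simp_all

/-- A jump is possible at the states at which some load is off and its frequency or the power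
command is at least at the upper threshold, or is on and both are at most at the lower
thresholds. -/
theorem mem_jumpSet_iff {ζ : P.State} : ζ ∈ P.jumpSet ↔ ζ ∈ P.Λ ∧ ∃ j,
    (ζ.σ j = 0 ∧ (P.ω1 j ≤ ζ.ω j ∨ P.pcHigh j ≤ P.pc)) ∨
      (ζ.σ j = 1 ∧ ζ.ω j ≤ P.ω0 j ∧ P.pc ≤ P.pcLow j) := by
  -- Violating the flow condition gives the strict inequalities and `jumpSwitch` the boundary cases.
  -- The ordering of the thresholds excludes the first branch when the load is on and below both
  -- lower thresholds.
  have key : ∀ j, (ζ.σ j = 0 ∨ ζ.σ j = 1) →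
      ((ζ.σ j ∉ P.flowSwitch j (ζ.ω j) ∨ ζ.σ j ∈ P.jumpSwitch j (ζ.ω j)) ↔
      (ζ.σ j = 0 ∧ (P.ω1 j ≤ ζ.ω j ∨ P.pcHigh j ≤ P.pc)) ∨
        (ζ.σ j = 1 ∧ ζ.ω j ≤ P.ω0 j ∧ P.pc ≤ P.pcLow j)) := by
    intro j hj
    have h1 := P.ω0_lt_ω1 j
    have h2 := P.pcLow_lt_pcHigh j
    rcases hj with h | h <;> rw [h] <;> unfold flowSwitch jumpSwitch <;>
      split_ifs <;> simp <;> grind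
  simp only [jumpSet, flowSet, mem_union, mem_sdiff, mem_ofPred_eq]
  constructor
  · rintro (⟨h, hn⟩ | ⟨h, j, hj⟩)
    · push Not at hn
      obtain ⟨j, hj⟩ := hn h
      exact ⟨h, j, (key j (h j)).1 (Or.inl hj)⟩
    · exact ⟨h, j, (key j (h j)).1 (Or.inr hj)⟩
  · rintro ⟨h, j, hj⟩
    rcases (key j (h j)).2 hj with h' | h'
    · exact Or.inl ⟨h, fun hC => h' (hC.2 j)⟩
    · exact Or.inr ⟨h, j, h'⟩

theorem isClosed_jumpSet : IsClosed P.jumpSet := by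
  have hσ : ∀ j, Continuous fun ζ : P.State => ζ.σ j := fun j => by
    unfold State.σ; fun_prop
  have hω : ∀ j, Continuous fun ζ : P.State => ζ.ω j := fun j => by
    unfold State.ω; fun_prop
  have hΛ : IsClosed P.Λ := by
    rw [Λ, ofPred_forall]
    exact isClosed_iInter fun j => (Set.toFinite {(0 : ℝ), 1}).isClosed.preimage (hσ j)
  have : P.jumpSet = P.Λ ∩ ⋃ j, {ζ : P.State |
    (ζ.σ j = 0 ∧ (P.ω1 j ≤ ζ.ω j ∨ P.pcHigh j ≤ P.pc)) ∨
      (ζ.σ j = 1 ∧ ζ.ω j ≤ P.ω0 j ∧ P.pc ≤ P.pcLow j)} := by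
    ext ζ
    rw [mem_jumpSet_iff]
    simp
  rw [this]
  refine hΛ.inter (isClosed_iUnion_of_finite fun j => ?_)
  exact ((isClosed_eq (hσ j) continuous_const).inter
    ((isClosed_le continuous_const (hω j)).union isClosed_const)).union
    ((isClosed_eq (hσ j) continuous_const).inter
      ((isClosed_le (hω j) continuous_const).inter isClosed_const))

variable [DecidableEq N]

/-- The switching states enter as ordinary real coordinates, so the flow is built on the whole
vector space; `flow_σ` then shows that it preserves `Λ`. -/
theorem isLinearMap_flowMap_sub : IsLinearMap ℝ fun ζ : P.State => P.flowMap ζ - P.flowMap 0 where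
  map_add x y := by
    refine Prod.ext ?_ (Prod.ext ?_ (Prod.ext ?_ ?_))
    · ext e; simp [flowMap, State.ω]; ring
    · ext j
      have h : ∀ (p : P.E → Prop) [DecidablePred p], (∑ e : P.E, if p e then
          P.lineFlow (x + y) e else 0) = (∑ e : P.E, if p e then P.lineFlow x e else 0) +
          ∑ e : P.E, if p e then P.lineFlow y e else 0 := by
        intro p _
        rw [← Finset.sum_add_distrib]
        refine Finset.sum_congr rfl fun e _ => ?_
        split_ifs <;> simp [lineFlow]
        ring
      have h0 : ∀ e, P.lineFlow 0 e = 0 := fun e => by simp [lineFlow]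
      simp only [flowMap, Prod.snd_sub, Prod.fst_sub, Pi.sub_apply, Prod.snd_add, Prod.fst_add,
        Pi.add_apply, h, h0, ite_self, Finset.sum_const_zero]
      simp [State.ω, State.pM, State.σ]
      ring
    · ext j; simp [flowMap, State.ω, State.pM]; ring
    · ext j; simp [flowMap]
  map_smul r x := by
    refine Prod.ext ?_ (Prod.ext ?_ (Prod.ext ?_ ?_))
    · ext e; simp [flowMap, State.ω]; ring
    · ext j
      have h : ∀ (p : P.E → Prop) [DecidablePred p], (∑ e : P.E, if p e then
          P.lineFlow (r • x) e else 0) = r * ∑ e : P.E, if p e then P.lineFlow x e else 0 := by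
        intro p _
        rw [Finset.mul_sum]
        refine Finset.sum_congr rfl fun e _ => ?_
        split_ifs <;> simp [lineFlow]
        ring
      have h0 : ∀ e, P.lineFlow 0 e = 0 := fun e => by simp [lineFlow]
      simp only [flowMap, Prod.snd_sub, Prod.fst_sub, Pi.sub_apply, Prod.smul_snd, Prod.smul_fst,
        Pi.smul_apply, h, h0, ite_self, Finset.sum_const_zero]
      simp [State.ω, State.pM, State.σ]
      ring
    · ext j; simp [flowMap, State.ω, State.pM]; ring
    · ext j; simp [flowMap]

/-- The linear part of the vector field of the continuous dynamics. -/
def flowLinear : P.State →L[ℝ] P.State :=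
  LinearMap.toContinuousLinearMap P.isLinearMap_flowMap_sub.mk'

theorem flowMap_eq (ζ : P.State) : P.flowMap ζ = P.flowLinear ζ + P.flowMap 0 := by
  simp [flowLinear]

/-- The flow of the continuous dynamics. -/
def flow : ℝ → P.State → P.State := affineFlow P.flowLinear (P.flowMap 0)

theorem flow_zero (z : P.State) : P.flow 0 z = z := affineFlow_zero _ _ _

theorem hasDerivAt_flow (z : P.State) (t : ℝ) :
    HasDerivAt (fun s => P.flow s z) (P.flowMap (P.flow t z)) t := by
  rw [flowMap_eq]
  exact hasDerivAt_affineFlow _ _ _ _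

theorem flow_σ (z : P.State) (t : ℝ) (j : N) : (P.flow t z).σ j = z.σ j := by
  have hd : ∀ s, HasDerivAt (fun s => (P.flow s z).σ j) 0 s := fun s =>
    hasDerivAt_pi.1 (P.hasDerivAt_flow z s).snd.snd.snd j
  have h := is_const_of_deriv_eq_zero (f := fun s => (P.flow s z).σ j)
    (fun s => (hd s).differentiableAt) (fun s => (hd s).deriv) t 0
  simpa [flow_zero] using h

theorem isFlow : P.hybridSystem.IsFlow P.flow where
  lipschitz := by
    refine ⟨‖P.flowLinear‖₊, fun x y => ?_⟩
    change edist (P.flowMap x) (P.flowMap y) ≤ _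
    rw [flowMap_eq, flowMap_eq P y, edist_add_right]
    exact P.flowLinear.lipschitz x y
  zero := P.flow_zero
  deriv := P.hasDerivAt_flow
  flow_mem z hz t := by
    have hz : z ∈ P.flowSet ∪ P.jumpSet := hz
    change _ ∈ P.flowSet ∪ P.jumpSet
    rw [flowSet_union_jumpSet] at hz ⊢
    intro j
    rw [flow_σ]
    exact hz j
  jump_mem z hz := by
    change _ ∈ P.flowSet ∪ P.jumpSet
    rw [flowSet_union_jumpSet]
    exact P.jumpMap_mem_Λ (P.mem_jumpSet_iff.1 hz).1
  isClosed := P.isClosed_jumpSet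

/-! ### Switching times -/

variable {P} {K : Set (ℝ × ℕ)} {ζ : ℝ → ℕ → P.State}

theorem mem_Λ_of_isSolution (hζ : P.hybridSystem.IsSolution K ζ) {s : ℝ} {l : ℕ}
    (h : (s, l) ∈ K) : ζ s l ∈ P.Λ := by
  rw [← flowSet_union_jumpSet]
  exact hζ.mem_union P.isFlow h

/-- A load that switches is switched on above an upper threshold or is switched off below both
lower thresholds. -/
theorem SwitchesAt.cases (hζ : P.hybridSystem.IsSolution K ζ) {j : N} {l : ℕ} {s : ℝ}
    (h : SwitchesAt K ζ j l s) :
    ((ζ s l).σ j = 0 ∧ (ζ s (l + 1)).σ j = 1 ∧ (P.ω1 j ≤ (ζ s l).ω j ∨ P.pcHigh j ≤ P.pc)) ∨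
    ((ζ s l).σ j = 1 ∧ (ζ s (l + 1)).σ j = 0 ∧ (ζ s l).ω j ≤ P.ω0 j ∧ P.pc ≤ P.pcLow j) := by
  obtain ⟨h1, h2, h3⟩ := h
  have hj := (hζ.jump l s h1 h2).2
  have hΛ : (ζ s l).σ j = 0 ∨ (ζ s l).σ j = 1 := mem_Λ_of_isSolution hζ h1 j
  have hσ : (ζ s (l + 1)).σ j = (P.jumpMap (ζ s l)).σ j := by rw [hj]; rfl
  rw [hσ] at h3 ⊢
  simp only [jumpMap] at h3 ⊢
  change (if _ then (1 : ℝ) else if _ then 0 else (ζ s l).σ j) ≠ _ at h3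
  change (_ ∧ (if _ then (1 : ℝ) else if _ then 0 else (ζ s l).σ j) = _ ∧ _) ∨
    (_ ∧ (if _ then (1 : ℝ) else if _ then 0 else (ζ s l).σ j) = _ ∧ _)
  split_ifs at h3 ⊢ with ha hb
  · exact Or.inl ⟨hΛ.resolve_right (Ne.symm h3), rfl, ha⟩
  · exact Or.inr ⟨hΛ.resolve_left (Ne.symm h3), rfl, hb⟩
  · exact absurd rfl h3

theorem ω_succ_eq (hζ : P.hybridSystem.IsSolution K ζ) {l : ℕ} {s : ℝ} (h1 : (s, l) ∈ K)
    (h2 : (s, l + 1) ∈ K) : (ζ s (l + 1)).ω = (ζ s l).ω := by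
  rw [(hζ.jump l s h1 h2).2]; rfl

/-- The switching state of a load is constant between consecutive switches. -/
theorem σ_eq_of_not_switchesAt (hζ : P.hybridSystem.IsSolution K ζ) {j : N} {l l' : ℕ}
    {s s' : ℝ} (hl : l ≤ l') (hs : s ≤ s') (h : (s, l) ∈ K) (h' : (s', l') ∈ K)
    (hn : ∀ m r, l ≤ m → m < l' → ¬ SwitchesAt K ζ j m r) : (ζ s' l').σ j = (ζ s l).σ j := by
  obtain ⟨t, h0, hm, hJ, hI, hS⟩ := hζ.domain.exists_jumpTimes
  induction l', hl using Nat.le_induction generalizing s' with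
  | base =>
    rw [hζ.eq_flow P.isFlow hs ((Icc_subset_Icc_left (hJ.le_of_mem h)).trans (hI _ _ h')), flow_σ]
  | succ k hk ih =>
    have hkt : (t (k + 1), k) ∈ K := by
      change _ ∈ hybridSlice K k
      rw [hS _ _ h' k (by simp)]
      exact right_mem_Icc.2 (hm (by simp))
    have hkt' := hI _ _ h' (left_mem_Icc.2 (hJ.le_of_mem h'))
    have hst : s ≤ t (k + 1) := by
      rcases hk.eq_or_lt with rfl | hlt
      · exact hJ.le_succ h h'
      · have : s ∈ hybridSlice K l := h
        rw [hS _ _ h' l (by omega)] at this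
        exact this.2.trans (hm (by omega))
    rw [hζ.eq_flow P.isFlow (hJ.le_of_mem h') (hI _ _ h'), flow_σ,
      ← ih hst hkt fun m r h1 h2 => hn m r h1 (by omega)]
    by_contra hne
    exact hn k _ hk (by simp) ⟨hkt, hkt', hne⟩

/-- The frequencies are Lipschitz continuous along a solution with bounded velocity. -/
theorem abs_ω_sub_le (hζ : P.hybridSystem.IsSolution K ζ) {C : ℝ}
    (hC : ∀ p ∈ K, ‖P.flowMap (ζ p.1 p.2)‖ ≤ C) (j : N) {l l' : ℕ} {s s' : ℝ} (hl : l ≤ l')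
    (hs : s ≤ s') (h : (s, l) ∈ K) (h' : (s', l') ∈ K) :
    |(ζ s' l').ω j - (ζ s l).ω j| ≤ C * (s' - s) := by
  obtain ⟨t, h0, hm, hJ, hI, hS⟩ := hζ.domain.exists_jumpTimes
  have hslice : ∀ {k a b}, a ≤ b → Icc a b ⊆ hybridSlice K k →
      |(ζ b k).ω j - (ζ a k).ω j| ≤ C * (b - a) := by
    intro k a b hab hsub
    have heq : ∀ r ∈ Icc a b, ζ r k = P.flow (r - a) (ζ a k) := fun r hr =>
      hζ.eq_flow P.isFlow hr.1 ((Icc_subset_Icc_right hr.2).trans hsub)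
    have hb := norm_image_sub_le_of_norm_deriv_le_segment' (a := a) (b := b) (C := C)
      (f := fun r => P.flow (r - a) (ζ a k))
      (fun r _ => (P.isFlow.deriv_sub (ζ a k) a r).hasDerivWithinAt)
      (fun r hr => by
        rw [← heq r (Ico_subset_Icc_self hr)]
        exact hC (r, k) (hsub (Ico_subset_Icc_self hr))) b (right_mem_Icc.2 hab)
    rw [← heq b (right_mem_Icc.2 hab), sub_self, flow_zero] at hb
    refine le_trans ?_ hb
    rw [← Real.norm_eq_abs]
    exact ((norm_le_pi_norm (ζ b k - ζ a k).2.1 j).trans (norm_fst_le _)).trans (norm_snd_le _)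
  induction l', hl using Nat.le_induction generalizing s' with
  | base => exact hslice hs ((Icc_subset_Icc_left (hJ.le_of_mem h)).trans (hI _ _ h'))
  | succ k hk ih =>
    have hkt : (t (k + 1), k) ∈ K := by
      change _ ∈ hybridSlice K k
      rw [hS _ _ h' k (by simp)]
      exact right_mem_Icc.2 (hm (by simp))
    have hkt' := hI _ _ h' (left_mem_Icc.2 (hJ.le_of_mem h'))
    have hst : s ≤ t (k + 1) := by
      rcases hk.eq_or_lt with rfl | hlt
      · exact hJ.le_succ h h'
      · have : s ∈ hybridSlice K l := h
        rw [hS _ _ h' l (by omega)] at this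
        exact this.2.trans (hm (by omega))
    have h1 := ih hst hkt
    have h2 := hslice (hJ.le_of_mem h') (hI _ _ h')
    -- Jumps do not move the frequency, so the bounds on adjacent slices add up.
    rw [ω_succ_eq hζ hkt hkt'] at h2
    calc _ ≤ _ := abs_sub_le _ ((ζ (t (k + 1)) k).ω j) _
      _ ≤ C * (s' - t (k + 1)) + C * (t (k + 1) - s) := add_le_add h2 h1
      _ = _ := by ring

/-- The time of a jump is at most the time of every later point of the domain. -/
theorem le_of_mem_of_lt (hK : IsHybridTimeDomain K) {l l' : ℕ} {s s' : ℝ} (h : (s, l) ∈ K)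
    (h' : (s', l') ∈ K) (hl : l < l') : s ≤ s' := by
  obtain ⟨t, h0, hm, hJ, hI, hS⟩ := hK.exists_jumpTimes
  have : s ∈ hybridSlice K l := h
  rw [hS _ _ h' l hl] at this
  exact (this.2.trans (hm hl)).trans (hJ.le_of_mem h')

/-- Two switches in the same direction are impossible, as the switching state is constant in
between. In an opposite pair, the bound on `P.pc` at the off-switch leaves only the frequency
condition for the on-switch. -/
theorem ω1_sub_ω0_le (hζ : P.hybridSystem.IsSolution K ζ) {C : ℝ}
    (hC : ∀ p ∈ K, ‖P.flowMap (ζ p.1 p.2)‖ ≤ C) {j : N} {s s' : ℝ}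
    (h : ConsecutiveSwitchTimes K ζ j s s') : P.ω1 j - P.ω0 j ≤ C * (s' - s) := by
  obtain ⟨l, l', hl, h1, h2, hn⟩ := h
  have hs : s ≤ s' := le_of_mem_of_lt hζ.domain h1.1 h2.1 hl
  have hσ := σ_eq_of_not_switchesAt hζ (j := j) (Nat.succ_le_of_lt hl) hs h1.2.1 h2.1
    fun m r hm hm' => hn m r (Nat.lt_of_succ_le hm) hm'
  have hω := abs_le.1 (abs_ω_sub_le hζ hC j hl.le hs h1.1 h2.1)
  have hp := P.pcLow_lt_pcHigh j
  rcases h1.cases hζ with ⟨a1, a2, a3⟩ | ⟨a1, a2, a3, a4⟩ <;>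
    rcases h2.cases hζ with ⟨b1, b2, b3⟩ | ⟨b1, b2, b3, b4⟩
  · rw [b1, Nat.succ_eq_add_one, a2] at hσ; norm_num at hσ
  · rcases a3 with a3 | a3 <;> linarith
  · rcases b3 with b3 | b3 <;> linarith
  · rw [b1, Nat.succ_eq_add_one, a2] at hσ; norm_num at hσ

/-- Along a bounded solution there is a positive dwell time between the switches of each load. -/
theorem exists_dwellTime (hζ : P.hybridSystem.IsSolution K ζ)
    (hB : Bornology.IsBounded {z | ∃ p ∈ K, z = ζ p.1 p.2}) :
    ∃ τ : ℝ, 0 < τ ∧ ∀ (j : N) (s s' : ℝ), ConsecutiveSwitchTimes K ζ j s s' → τ ≤ s' - s := by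
  obtain ⟨k, hk⟩ := P.isFlow.lipschitz
  obtain ⟨R, hR⟩ := (hk.isBounded_image hB).exists_norm_le
  -- The maximum with `1` keeps the speed bound positive, so that it can be divided by.
  have hC : ∀ p ∈ K, ‖P.flowMap (ζ p.1 p.2)‖ ≤ max R 1 := fun p hp =>
    (hR _ (mem_image_of_mem _ ⟨p, hp, rfl⟩)).trans (le_max_left _ _)
  have hpos : 0 < max R 1 := lt_of_lt_of_le one_pos (le_max_right _ _)
  have : Nonempty N := P.connected.nonempty
  obtain ⟨i, hi⟩ := Finite.exists_min fun j => P.ω1 j - P.ω0 j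
  refine ⟨(P.ω1 i - P.ω0 i) / max R 1, div_pos (sub_pos.2 (P.ω0_lt_ω1 i)) hpos,
    fun j s s' h => ?_⟩
  rw [div_le_iff₀' hpos]
  exact (hi j).trans (ω1_sub_ω0_le hζ hC h)

/-- A positive dwell time excludes infinitely many switches in bounded time. -/
theorem finite_switches_of_dwellTime (hζ : P.hybridSystem.IsSolution K ζ) {j : N} {τ : ℝ}
    (hτ : 0 < τ) (h : ∀ s s', ConsecutiveSwitchTimes K ζ j s s' → τ ≤ s' - s) (T : ℝ) :
    {l : ℕ | ∃ t ≤ T, SwitchesAt K ζ j l t}.Finite := by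
  by_contra hinf
  have hinf : {l : ℕ | ∃ t ≤ T, SwitchesAt K ζ j l t}.Infinite := hinf
  set p : ℕ → Prop := fun l => ∃ t ≤ T, SwitchesAt K ζ j l t with hp
  classical
  choose r hrT hr using fun n => Nat.nth_mem_of_infinite (p := p) hinf n
  obtain ⟨t, h0, hm, hJ, hI, hS⟩ := hζ.domain.exists_jumpTimes
  have hmono := Nat.nth_strictMono (p := p) hinf
  have hgrow : ∀ n : ℕ, n * τ ≤ r n := by
    intro n
    induction n with
    | zero =>
      have := (hm (Nat.zero_le _)).trans (hJ.le_of_mem (hr 0).1)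
      simpa [h0] using this
    | succ n ih =>
      have := h (r n) (r (n + 1)) ⟨_, _, hmono (Nat.lt_succ_self n), hr n, hr (n + 1), by
        intro m q h1 h2 hq
        -- A switch in between would also occur by time `T`, hence be part of the enumeration, which
        -- skips no index.
        have hpm : p m := ⟨q, (le_of_mem_of_lt hζ.domain hq.1 (hr (n + 1)).1 h2).trans
          (hrT (n + 1)), hq⟩
        rw [← Nat.nth_count hpm, hmono.lt_iff_lt] at h1 h2
        omega⟩
      push_cast
      linarith
  obtain ⟨n, hn⟩ := exists_nat_gt (T / τ)
  have := (div_lt_iff₀ hτ).1 hn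
  linarith [hgrow n, hrT n]

end PowerNetwork

end

theorem mainTheorem7 {N : Type*} [Fintype N] [DecidableEq N] (P : PowerNetwork N) :
    (∀ ζ₀ ∈ P.Λ, ∃ (K : Set (ℝ × ℕ)) (ζ : ℝ → ℕ → P.State),
      P.hybridSystem.IsCompleteSolution K ζ ∧ ζ 0 0 = ζ₀) ∧
    (∀ (K : Set (ℝ × ℕ)) (ζ : ℝ → ℕ → P.State),
      P.hybridSystem.IsMaximalSolution K ζ → P.hybridSystem.IsCompleteSolution K ζ) ∧
    (∀ (K : Set (ℝ × ℕ)) (ζ : ℝ → ℕ → P.State),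
      P.hybridSystem.IsCompleteSolution K ζ →
      Bornology.IsBounded {z | ∃ p ∈ K, z = ζ p.1 p.2} →
      (∃ τ : ℝ, 0 < τ ∧ ∀ (j : N) (s s' : ℝ),
        PowerNetwork.ConsecutiveSwitchTimes K ζ j s s' → τ ≤ s' - s) ∧
      (∀ (j : N) (T : ℝ),
        {l : ℕ | ∃ t ≤ T, PowerNetwork.SwitchesAt K ζ j l t}.Finite)) := by
  refine ⟨fun ζ₀ h => ?_, fun K ζ h => h.isComplete P.isFlow, fun K ζ h hB => ?_⟩
  · rw [← PowerNetwork.flowSet_union_jumpSet] at h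
    exact P.isFlow.exists_complete h
  · obtain ⟨τ, hτ, hdwell⟩ := PowerNetwork.exists_dwellTime h.1 hB
    exact ⟨⟨τ, hτ, hdwell⟩, fun j T =>
      PowerNetwork.finite_switches_of_dwellTime h.1 hτ (hdwell j) T⟩
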